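/- Let $X$ be a nonempty Tychonoff space, and let $C_p(X)$ be the space of continuous real-valued functions on $X$ with the topology of pointwise convergence. Notation. For families $\mathcal A,\mathcal B$ of subsets of a set, $S_1(\mathcal A,\mathcal B)$ says: for every sequence $(A_n)_{n\in\mathbb N}$ of members of $\mathcal A$ there are $b_n\in A_n$ with $\{b_n:n\in\mathbb N\}\in\mathcal B$; and $S_{fin}(\mathcal A,\mathcal B)$ says: for every such sequence there are finite sets $B_n\subseteq A_n$ with $\bigcup_n B_n\in\mathcal B$. For a topological space $Y$: * $\mathcal D$ is the family of dense subsets of $Y$, and $\mathcal S$ the family of sequentially dense subsets, i.e. those $D\subseteq Y$ such that every point of $Y$ is the limit of a sequence of points of $D$. * For $y\in Y$, $\Omega_y=\{A\subseteq Y: y\in\overline A\setminus A\}$, and $\Gamma_y$ is the family of infinite sets $A\subseteq Y$ with $y\notin A$ such that $A\setminus U$ is finite for every neighbourhood $U$ of $y$. * $\Omega$ is the family of open covers $\mathcal U$ of $Y$ with $Y\notin\mathcal U$ such that every finite subset of $Y$ is contained in a member of $\mathcal U$; $\Gamma$ is the family of infinite open covers $\mathcal U$ of $Y$ with $Y\notin\mathcal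 U$ such that each point of $Y$ belongs to all but finitely many members of $\mathcal U$. We write $Y\models S(\mathcal A,\mathcal B)$ when the principle holds for these families of $Y$; a principle that involves $\Omega_y$ or $\Gamma_y$ is required for every $y\in Y$ (written with subscript $x$ below, with $x$ ranging over the points of $C_p(X)$). The $i$-weight $iw(X)$ is the least infinite cardinal $\tau$ such that there is a one-to-one continuous map of $X$ onto a Tychonoff space of weight at most $\tau$. Then the following are equivalent: 1. $C_p(X)\models S_1(\mathcal D,\mathcal S)$; 2. every dense subset of $C_p(X)$ is sequentially dense, and $C_p(X)$ is separable; 3. $X\models S_1(\Omega,\Gamma)$ and $iw(X)=\aleph_0$; 4. $C_p(X)\models S_1(\Omega_x,\Gamma_x)$ and $C_p(X)$ is separable; 5. $C_p(X)\models S_1(\mathcal D,\Gamma_x)$ and $C_p(X)$ is separable; 6. $C_p(X)\models S_{fin}(\mathcal D,\mathcal S)$; 7. $X\models S_{fin}(\Omega,\Gamma)$ and $iw(X)=\aleph_0$; 8. $C_p(X)\models S_{fin}(\Omega_x,\Gamma_x)$ and $C_p(X)$ is separable; 9. $C_p(X)\models S_{fin}(\mathcal D,\Gamma_x)$ and $C_p(X)$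 is separable. -/

import Mathlib

open Topology Filter Cardinal

universe u

/-- The selection principle `S₁(𝒜, ℬ)`: from every sequence of members of `𝒜` one can pick one
element of each so that the set of the chosen elements is a member of `ℬ`. -/
def SelOne {α : Type u} (𝒜 ℬ : Set (Set α)) : Prop :=
  ∀ A : ℕ → Set α, (∀ n, A n ∈ 𝒜) →
    ∃ b : ℕ → α, (∀ n, b n ∈ A n) ∧ Set.range b ∈ ℬ

/-- The selection principle `S_fin(𝒜, ℬ)`: from every sequence of members of `𝒜` one can pick a
finite subset of each so that the union of the chosen subsets is a member of `ℬ`. -/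
def SelFin {α : Type u} (𝒜 ℬ : Set (Set α)) : Prop :=
  ∀ A : ℕ → Set α, (∀ n, A n ∈ 𝒜) →
    ∃ B : ℕ → Set α, (∀ n, (B n).Finite ∧ B n ⊆ A n) ∧ (⋃ n, B n) ∈ ℬ

/-- `𝒰` is a (nontrivial) open cover of `X`: its members are open and cover `X`, and `X` itself
is not a member. -/
def IsNontrivialOpenCover {X : Type u} [TopologicalSpace X] (𝒰 : Set (Set X)) : Prop :=
  (∀ U ∈ 𝒰, IsOpen U) ∧ ⋃₀ 𝒰 = Set.univ ∧ Set.univ ∉ 𝒰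

/-- `Ω`: the open `ω`-covers of `X`. -/
def OmegaCovers (X : Type u) [TopologicalSpace X] : Set (Set (Set X)) :=
  {𝒰 | IsNontrivialOpenCover 𝒰 ∧ ∀ F : Set X, F.Finite → ∃ U ∈ 𝒰, F ⊆ U}

/-- `Γ`: the open `γ`-covers of `X`. -/
def GammaCovers (X : Type u) [TopologicalSpace X] : Set (Set (Set X)) :=
  {𝒰 | IsNontrivialOpenCover 𝒰 ∧ 𝒰.Infinite ∧ ∀ x : X, {U ∈ 𝒰 | x ∉ U}.Finite}

/-- `𝒟`: the dense subsets of `Y`. -/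
def DenseSets (Y : Type u) [TopologicalSpace Y] : Set (Set Y) :=
  {D | Dense D}

/-- `𝒮`: the sequentially dense subsets of `Y`, those whose sequences have every point of `Y`
as a limit. -/
def SeqDenseSets (Y : Type u) [TopologicalSpace Y] : Set (Set Y) :=
  {D | seqClosure D = Set.univ}

/-- `Ω_y`: the sets `A` with `y ∈ closure A \ A`. -/
def OmegaAt {Y : Type u} [TopologicalSpace Y] (y : Y) : Set (Set Y) :=
  {A | y ∈ closure A \ A}

/-- `Γ_y`: the sets `A` that converge to `y`, that is, `A` is infinite, `y ∉ A`, and `A \ U` is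
finite for every neighbourhood `U` of `y`. -/
def GammaAt {Y : Type u} [TopologicalSpace Y] (y : Y) : Set (Set Y) :=
  {A | A.Infinite ∧ y ∉ A ∧ ∀ U ∈ 𝓝 y, (A \ U).Finite}

/-- Every dense subset of `Y` is sequentially dense. -/
def StronglySeqDenseInItself (Y : Type u) [TopologicalSpace Y] : Prop :=
  ∀ D ∈ DenseSets Y, D ∈ SeqDenseSets Y

/-- The weight of `Y`: the least cardinality of a base of its topology. -/
noncomputable def topWeight (Y : Type u) [TopologicalSpace Y] : Cardinal.{u} :=
  sInf {κ | ∃ B : Set (Set Y), TopologicalSpace.IsTopologicalBasis B ∧ #B = κ}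

/-- The `i`-weight of `X`: the least infinite cardinal `τ` such that `X` has a one-to-one
continuous mapping onto a Tychonoff space of weight at most `τ`. (Such a space is in bijection
with `X`, so it can be taken in the universe of `X`.) -/
noncomputable def iWeight (X : Type u) [TopologicalSpace X] : Cardinal.{u} :=
  sInf {τ | ℵ₀ ≤ τ ∧ ∃ (Y : Type u) (_ : TopologicalSpace Y) (f : X → Y),
    T35Space Y ∧ Continuous f ∧ Function.Bijective f ∧ topWeight Y ≤ τ}

/-- `C_p(X)`: the continuous real-valued functions on `X`, with the topology of pointwise
convergence (the subspace topology inherited from the product `X → ℝ`). -/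
abbrev Cp (X : Type u) [TopologicalSpace X] : Type u :=
  {f : X → ℝ // Continuous f}

/-!
The equivalence of the conditions on `X` with those on `C_p(X)` goes through the theorem of
Gerlits and Nagy. The functions that equal `1` off some member of an `ω`-cover of `X` are dense in
`C_p(X)`, and a sequence of them that converges to `0` yields a sequence of members of the cover
whose lower limit is `X`. Conversely, applying this extraction property to the cover formed by the
sets `(u₀ ∩ ⋯ ∩ uₙ) \ {pₙ}`, with `uᵢ` in the `i`-th cover and the `pₙ` distinct, upgrades it to a
selection from a sequence of covers, because removing the points `pₙ` forces `n → ∞`. Selecting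
from the covers by the sets `{x | |g x - f x| < 1 / (n + 1)}` then makes `C_p(X)` strictly Fréchet.

The condition on the `i`-weight corresponds to separability (Noble): evaluation at a countable
dense set of functions injects `X` into `ℝ^ℕ`; conversely, an injection of `X` into the metrizable
compactum `[-∞, ∞]^ℕ` turns the separable space of continuous functions on that compactum into a
dense set of restrictions to `X`.
-/

section SelectionPrinciples

variable {α : Type u} {𝒜 𝒜' ℬ : Set (Set α)}

lemma SelOne.selFin (h : SelOne 𝒜 ℬ) : SelFin 𝒜 ℬ := by
  intro A hA
  obtain ⟨b, hb, hrange⟩ := h A hA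
  refine ⟨fun n => {b n}, fun n => ⟨Set.finite_singleton _, Set.singleton_subset_iff.2 (hb n)⟩, ?_⟩
  rwa [Set.iUnion_singleton_eq_range]

lemma SelOne.of_forall_exists_subset (h : SelOne 𝒜' ℬ) (hsub : ∀ A ∈ 𝒜, ∃ A' ∈ 𝒜', A' ⊆ A) :
    SelOne 𝒜 ℬ := by
  intro A hA
  choose A' hA' hA'A using fun n => hsub (A n) (hA n)
  obtain ⟨b, hb, hrange⟩ := h A' hA'
  exact ⟨b, fun n => hA'A n (hb n), hrange⟩

lemma SelFin.of_forall_exists_subset (h : SelFin 𝒜' ℬ) (hsub : ∀ A ∈ 𝒜, ∃ A' ∈ 𝒜', A' ⊆ A) :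
    SelFin 𝒜 ℬ := by
  intro A hA
  choose A' hA' hA'A using fun n => hsub (A n) (hA n)
  obtain ⟨B, hB, hunion⟩ := h A' hA'
  exact ⟨B, fun n => ⟨(hB n).1, (hB n).2.trans (hA'A n)⟩, hunion⟩

lemma SelFin.exists_countable_subset (h : SelFin 𝒜 ℬ) {A : Set α} (hA : A ∈ 𝒜) :
    ∃ B ⊆ A, B.Countable ∧ B ∈ ℬ := by
  obtain ⟨B, hB, hunion⟩ := h (fun _ => A) (fun _ => hA)
  exact ⟨_, Set.iUnion_subset fun n => (hB n).2,
    Set.countable_iUnion fun n => (hB n).1.countable, hunion⟩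

end SelectionPrinciples

section Sequences

variable {α : Type*}

lemma finite_range_diff_of_eventually_mem {b : ℕ → α} {U : Set α} (h : ∀ᶠ n in atTop, b n ∈ U) :
    (Set.range b \ U).Finite := by
  rw [← Nat.cofinite_eq_atTop, eventually_cofinite] at h
  refine (h.image b).subset ?_
  rintro _ ⟨⟨n, rfl⟩, hn⟩
  exact ⟨n, hn, rfl⟩

lemma infinite_range_of_eventually_ne {b : ℕ → α} (h : ∀ m, ∀ᶠ n in atTop, b n ≠ b m) :
    (Set.range b).Infinite := by
  intro hfin
  have hne : ∀ᶠ n in atTop, ∀ a ∈ Set.range b, b n ≠ a :=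
    (eventually_all_finite hfin).2 (Set.forall_mem_range.2 h)
  obtain ⟨n, hn⟩ := hne.exists
  exact hn (b n) ⟨n, rfl⟩ rfl

lemma exists_seq_eventually_mem_of_infinite {A : Set α} (hA : A.Infinite) :
    ∃ b : ℕ → α, (∀ n, b n ∈ A) ∧ ∀ U, (A \ U).Finite → ∀ᶠ n in atTop, b n ∈ U := by
  let b : ℕ → α := fun n => hA.natEmbedding A n
  have hb : Function.Injective b := Subtype.val_injective.comp (hA.natEmbedding A).injective
  have hbA : ∀ n, b n ∈ A := fun n => (hA.natEmbedding A n).2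
  refine ⟨b, hbA, fun U hU => ?_⟩
  rw [← Nat.cofinite_eq_atTop, eventually_cofinite]
  exact (hU.preimage hb.injOn).subset fun n hn => ⟨hbA n, hn⟩

end Sequences

section Convergence

open TopologicalSpace

variable {Y : Type u} [TopologicalSpace Y]

lemma range_mem_gammaAt [T1Space Y] {y : Y} {b : ℕ → Y} (hne : ∀ n, b n ≠ y)
    (hb : Tendsto b atTop (𝓝 y)) : Set.range b ∈ GammaAt y :=
  ⟨infinite_range_of_eventually_ne fun m => hb.eventually_ne (hne m).symm,
    fun ⟨n, hn⟩ => hne n hn,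
    fun _ hU => finite_range_diff_of_eventually_mem (hb.eventually_mem hU)⟩

lemma mem_seqClosure_of_subset_of_mem_gammaAt {y : Y} {A D : Set Y} (hAD : A ⊆ D)
    (hA : A ∈ GammaAt y) : y ∈ seqClosure D := by
  obtain ⟨b, hb, hlim⟩ := exists_seq_eventually_mem_of_infinite hA.1
  exact ⟨b, fun n => hAD (hb n), fun U hU => hlim U (hA.2.2 U hU)⟩

lemma seqClosure_mono {A B : Set Y} (h : A ⊆ B) : seqClosure A ⊆ seqClosure B :=
  fun _ ⟨b, hb, hlim⟩ => ⟨b, fun n => h (hb n), hlim⟩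

lemma mem_seqDenseSets_mono {A B : Set Y} (h : A ⊆ B) (hA : A ∈ SeqDenseSets Y) :
    B ∈ SeqDenseSets Y :=
  Set.univ_subset_iff.1 (hA.symm.subset.trans (seqClosure_mono h))

lemma dense_of_mem_seqDenseSets {A : Set Y} (hA : A ∈ SeqDenseSets Y) : Dense A :=
  fun y => seqClosure_subset_closure (hA.symm.subset (Set.mem_univ y))

lemma exists_subset_mem_omegaAt_of_dense [T1Space Y] (y : Y) [NeBot (𝓝[≠] y)] {D : Set Y}
    (hD : Dense D) : ∃ A ∈ OmegaAt y, A ⊆ D :=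
  ⟨D \ {y}, ⟨hD.sdiff_singleton y y, fun hy => hy.2 rfl⟩, Set.sdiff_subset⟩

lemma SelFin.stronglySeqDenseInItself (h : SelFin (DenseSets Y) (SeqDenseSets Y)) :
    StronglySeqDenseInItself Y := by
  intro D hD
  obtain ⟨B, hBD, -, hB⟩ := h.exists_countable_subset hD
  exact mem_seqDenseSets_mono hBD hB

lemma SelFin.separableSpace (h : SelFin (DenseSets Y) (SeqDenseSets Y)) :
    SeparableSpace Y := by
  obtain ⟨B, -, hB, hdense⟩ := h.exists_countable_subset dense_univ
  exact ⟨B, hB, dense_of_mem_seqDenseSets hdense⟩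

lemma stronglySeqDenseInItself_of_selFin_gammaAt
    (h : ∀ y : Y, SelFin (DenseSets Y) (GammaAt y)) : StronglySeqDenseInItself Y := by
  refine fun D hD => Set.eq_univ_of_forall fun y => ?_
  obtain ⟨B, hBD, -, hB⟩ := (h y).exists_countable_subset hD
  exact mem_seqClosure_of_subset_of_mem_gammaAt hBD hB

end Convergence

section StrictlyFrechet

open TopologicalSpace

/-- Strictly Fréchet spaces: a point in the closure of each set of a sequence is the limit of a
selection from that sequence. The sets are not required to decrease. -/
def StrictlyFrechet (Y : Type u) [TopologicalSpace Y] : Prop :=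
  ∀ (y : Y) (A : ℕ → Set Y), (∀ n, y ∈ closure (A n)) →
    ∃ b : ℕ → Y, (∀ n, b n ∈ A n) ∧ Tendsto b atTop (𝓝 y)

variable {Y : Type u} [TopologicalSpace Y]

lemma StrictlyFrechet.seqClosure_eq_closure (h : StrictlyFrechet Y) (A : Set Y) :
    seqClosure A = closure A :=
  seqClosure_subset_closure.antisymm fun y hy => h y (fun _ => A) fun _ => hy

lemma StrictlyFrechet.selOne_omegaAt_gammaAt [T1Space Y] (h : StrictlyFrechet Y) (y : Y) :
    SelOne (OmegaAt y) (GammaAt y) := by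
  intro A hA
  obtain ⟨b, hb, hlim⟩ := h y A fun n => (hA n).1
  exact ⟨b, hb, range_mem_gammaAt (fun n hn => (hA n).2 (hn ▸ hb n)) hlim⟩

lemma StrictlyFrechet.selOne_dense_dense [Nonempty Y] [SeparableSpace Y]
    (h : StrictlyFrechet Y) : SelOne (DenseSets Y) (DenseSets Y) := by
  intro A hA
  let d := denseSeq Y
  choose b hb hlim using fun k => h (d k) (fun m => A (Nat.pair k m)) fun m => hA _ _
  let c : ℕ → Y := fun n => b n.unpair.1 n.unpair.2
  have hc : ∀ k m, c (Nat.pair k m) = b k m := fun k m => by simp only [c, Nat.unpair_pair]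
  refine ⟨c, fun n => by simpa only [Nat.pair_unpair] using hb n.unpair.1 n.unpair.2, ?_⟩
  refine dense_closure.1 ((denseRange_denseSeq Y).mono ?_)
  rintro _ ⟨k, rfl⟩
  exact mem_closure_of_tendsto (hlim k) (.of_forall fun m => ⟨Nat.pair k m, hc k m⟩)

lemma StrictlyFrechet.selOne_dense_seqDense [Nonempty Y] [SeparableSpace Y]
    (h : StrictlyFrechet Y) : SelOne (DenseSets Y) (SeqDenseSets Y) := by
  intro A hA
  obtain ⟨b, hb, hdense⟩ := h.selOne_dense_dense A hA
  exact ⟨b, hb, (h.seqClosure_eq_closure _).trans hdense.closure_eq⟩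

end StrictlyFrechet

section Covers

/-- `U` has lower limit `X`: each point belongs to all but finitely many terms. This is the
sequence form of a `γ`-cover, with repetitions and the term `X` allowed. -/
def IsGammaSequence {X : Type u} (U : ℕ → Set X) : Prop :=
  ∀ x, ∀ᶠ n in atTop, x ∈ U n

/-- An open `ω`-cover in the wide sense, with `X` itself allowed as a member. -/
def IsOpenOmegaFamily {X : Type u} [TopologicalSpace X] (𝒰 : Set (Set X)) : Prop :=
  (∀ U ∈ 𝒰, IsOpen U) ∧ ∀ F : Set X, F.Finite → ∃ U ∈ 𝒰, F ⊆ U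

/-- Property `(γ)` of Gerlits and Nagy: each open `ω`-cover contains a sequence with lower limit
`X`. -/
def IsGammaSpace (X : Type u) [TopologicalSpace X] : Prop :=
  ∀ 𝒰 ∈ OmegaCovers X, ∃ U : ℕ → Set X, (∀ n, U n ∈ 𝒰) ∧ IsGammaSequence U

/-- The selective form of property `(γ)`: each sequence of open `ω`-covers in the wide sense has a
selection with lower limit `X`. -/
def HasGammaSelections (X : Type u) [TopologicalSpace X] : Prop :=
  ∀ 𝒰 : ℕ → Set (Set X), (∀ n, IsOpenOmegaFamily (𝒰 n)) →
    ∃ U : ℕ → Set X, (∀ n, U n ∈ 𝒰 n) ∧ IsGammaSequence U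

variable {X : Type u}

/-- The sets `(u 0 ∩ ⋯ ∩ u n) \ {p n}` with `u i ∈ 𝒰 i`. Removing `p n` keeps a sequence of such
sets with lower limit `X` from having bounded indices `n`. -/
def puncturedMeets (p : ℕ → X) (𝒰 : ℕ → Set (Set X)) : Set (Set X) :=
  {V | ∃ n, ∃ u : ℕ → Set X, (∀ i, u i ∈ 𝒰 i) ∧ V = (⋂ i ∈ Set.Iic n, u i) \ {p n}}

lemma exists_isGammaSequence_of_puncturedMeets {p : ℕ → X} {𝒰 : ℕ → Set (Set X)}
    {V : ℕ → Set X} (hV : ∀ k, V k ∈ puncturedMeets p 𝒰) (hγ : IsGammaSequence V) :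
    ∃ U : ℕ → Set X, (∀ n, U n ∈ 𝒰 n) ∧ IsGammaSequence U := by
  choose N u hu hVu using hV
  have hN : Tendsto N atTop atTop := by
    refine tendsto_atTop.2 fun i => ?_
    have hp : ∀ᶠ k in atTop, ∀ j ∈ Set.Iio i, p j ∈ V k :=
      (eventually_all_finite (Set.finite_Iio i)).2 fun j _ => hγ (p j)
    filter_upwards [hp] with k hk
    by_contra! hlt
    exact ((hVu k).subset (hk (N k) hlt)).2 rfl
  choose k hik hiN using fun i =>
    ((eventually_ge_atTop i).and (hN.eventually_ge_atTop i)).exists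
  refine ⟨fun i => u (k i) i, fun i => hu (k i) i, fun x => ?_⟩
  filter_upwards [(tendsto_atTop_mono hik tendsto_id).eventually (hγ x)] with i hi
  exact Set.mem_iInter₂.1 ((hVu (k i)).subset hi).1 i (hiN i)

variable [TopologicalSpace X]

lemma mem_omegaCovers_iff {𝒰 : Set (Set X)} :
    𝒰 ∈ OmegaCovers X ↔ IsOpenOmegaFamily 𝒰 ∧ Set.univ ∉ 𝒰 := by
  refine ⟨fun h => ⟨⟨h.1.1, h.2⟩, h.1.2.2⟩, fun ⟨h, huniv⟩ => ⟨⟨h.1, ?_, huniv⟩, h.2⟩⟩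
  refine Set.eq_univ_of_forall fun x => ?_
  obtain ⟨U, hU, hxU⟩ := h.2 {x} (Set.finite_singleton x)
  exact ⟨U, hU, hxU rfl⟩

lemma range_mem_gammaCovers {U : ℕ → Set X} (hopen : ∀ n, IsOpen (U n))
    (hne : ∀ n, U n ≠ Set.univ) (hU : IsGammaSequence U) : Set.range U ∈ GammaCovers X := by
  refine ⟨⟨Set.forall_mem_range.2 hopen, ?_, fun ⟨n, hn⟩ => hne n hn⟩, ?_, fun x => ?_⟩
  · exact Set.eq_univ_of_forall fun x => (hU x).exists.elim fun n hn => ⟨U n, ⟨n, rfl⟩, hn⟩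
  · refine infinite_range_of_eventually_ne fun m => ?_
    obtain ⟨x, hx⟩ := (Set.ne_univ_iff_exists_notMem _).1 (hne m)
    exact (hU x).mono fun n hn hnm => hx (hnm ▸ hn)
  · exact finite_range_diff_of_eventually_mem (U := {V | x ∈ V}) (hU x)

lemma exists_isGammaSequence_of_mem_gammaCovers {𝒱 : Set (Set X)} (h : 𝒱 ∈ GammaCovers X) :
    ∃ U : ℕ → Set X, (∀ n, U n ∈ 𝒱) ∧ IsGammaSequence U := by
  obtain ⟨U, hU, hev⟩ := exists_seq_eventually_mem_of_infinite h.2.1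
  exact ⟨U, hU, fun x => hev {V | x ∈ V} (h.2.2 x)⟩

lemma SelFin.isGammaSpace (h : SelFin (OmegaCovers X) (GammaCovers X)) : IsGammaSpace X := by
  intro 𝒰 h𝒰
  obtain ⟨𝒱, hsub, -, h𝒱⟩ := h.exists_countable_subset h𝒰
  obtain ⟨U, hU, hγ⟩ := exists_isGammaSequence_of_mem_gammaCovers h𝒱
  exact ⟨U, fun n => hsub (hU n), hγ⟩

lemma HasGammaSelections.selOne (h : HasGammaSelections X) :
    SelOne (OmegaCovers X) (GammaCovers X) := by
  intro A hA
  have hΩ := fun n => mem_omegaCovers_iff.1 (hA n)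
  obtain ⟨U, hU, hγ⟩ := h A fun n => (hΩ n).1
  exact ⟨U, hU, range_mem_gammaCovers (fun n => (hΩ n).1.1 _ (hU n))
    (fun n hn => (hΩ n).2 (hn ▸ hU n)) hγ⟩

lemma hasGammaSelections_of_finite [Finite X] : HasGammaSelections X := by
  intro 𝒰 h𝒰
  choose U hU hsub using fun n => (h𝒰 n).2 Set.univ Set.finite_univ
  exact ⟨U, hU, fun x => .of_forall fun n => hsub n (Set.mem_univ x)⟩

lemma puncturedMeets_mem_omegaCovers [T1Space X] {p : ℕ → X} (hp : Function.Injective p)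
    {𝒰 : ℕ → Set (Set X)} (h𝒰 : ∀ n, IsOpenOmegaFamily (𝒰 n)) :
    puncturedMeets p 𝒰 ∈ OmegaCovers X := by
  refine mem_omegaCovers_iff.2 ⟨⟨?_, fun F hF => ?_⟩, ?_⟩
  · rintro _ ⟨n, u, hu, rfl⟩
    exact ((Set.finite_Iic n).isOpen_biInter fun i _ => (h𝒰 i).1 _ (hu i)).sdiff
      isClosed_singleton
  · obtain ⟨n, hn⟩ : ∃ n, p n ∉ F := (hF.preimage hp.injOn).exists_notMem
    choose u hu hFu using fun i => (h𝒰 i).2 F hF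
    exact ⟨_, ⟨n, u, hu, rfl⟩,
      Set.subset_sdiff_singleton (Set.subset_iInter₂ fun i _ => hFu i) hn⟩
  · rintro ⟨n, u, -, hV⟩
    exact (hV.subset (Set.mem_univ (p n))).2 rfl

lemma IsGammaSpace.hasGammaSelections [T1Space X] (h : IsGammaSpace X) :
    HasGammaSelections X := by
  cases finite_or_infinite X with
  | inl hfin => exact hasGammaSelections_of_finite
  | inr hinf =>
    intro 𝒰 h𝒰
    have hp : Function.Injective (Infinite.natEmbedding X) := (Infinite.natEmbedding X).injective
    obtain ⟨V, hV, hγ⟩ := h _ (puncturedMeets_mem_omegaCovers hp h𝒰)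
    exact exists_isGammaSequence_of_puncturedMeets hV hγ

end Covers

section FunctionSpace

variable {X : Type u} [TopologicalSpace X]

instance Cp.instNonempty : Nonempty (Cp X) := ⟨⟨fun _ => 0, continuous_const⟩⟩

lemma Cp.tendsto_iff {ι : Type*} {l : Filter ι} {b : ι → Cp X} {f : Cp X} :
    Tendsto b l (𝓝 f) ↔ ∀ x, Tendsto (fun i => (b i).1 x) l (𝓝 (f.1 x)) := by
  rw [tendsto_subtype_rng, tendsto_pi_nhds]

lemma Cp.continuous_eval (x : X) : Continuous fun f : Cp X => f.1 x :=
  (continuous_apply x).comp continuous_subtype_val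

lemma Cp.eventually_nhds_dist_lt (f : Cp X) {F : Set X} (hF : F.Finite) {ε : ℝ} (hε : 0 < ε) :
    ∀ᶠ g in 𝓝 f, ∀ x ∈ F, dist (g.1 x) (f.1 x) < ε :=
  (eventually_all_finite hF).2 fun x _ =>
    (Cp.continuous_eval x).continuousAt.eventually (Metric.ball_mem_nhds _ hε)

lemma Cp.mem_closure_of_forall_finite_eqOn {A : Set (Cp X)} {f : Cp X}
    (h : ∀ F : Set X, F.Finite → ∃ g ∈ A, Set.EqOn g.1 f.1 F) : f ∈ closure A := by
  rw [mem_closure_iff_nhds]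
  intro U hU
  obtain ⟨W, hW, hWU⟩ := (mem_nhds_subtype _ _ _).1 hU
  rw [nhds_pi, Filter.mem_pi] at hW
  obtain ⟨F, hF, t, ht, htW⟩ := hW
  obtain ⟨g, hgA, hgF⟩ := h F hF
  exact ⟨g, hWU (htW fun x hx => hgF hx ▸ mem_of_mem_nhds (ht x)), hgA⟩

instance Cp.neBot_nhdsNE [Nonempty X] (f : Cp X) : NeBot (𝓝[≠] f) := by
  let shift : ℝ → Cp X := fun c => ⟨fun x => f.1 x + c, f.2.add continuous_const⟩
  have hlim : Tendsto shift (𝓝[≠] 0) (𝓝 f) := Cp.tendsto_iff.2 fun x =>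
    ((continuous_const_add (f.1 x)).tendsto' 0 (f.1 x) (add_zero _)).mono_left nhdsWithin_le_nhds
  have hne : ∀ᶠ c in 𝓝[≠] (0 : ℝ), shift c ≠ f := by
    filter_upwards [self_mem_nhdsWithin] with c hc hcf
    exact hc (add_eq_left.1 (congrFun (congrArg Subtype.val hcf) (Classical.arbitrary X)))
  exact (tendsto_nhdsWithin_iff.2 ⟨hlim, hne⟩).neBot

lemma HasGammaSelections.strictlyFrechet_cp (h : HasGammaSelections X) :
    StrictlyFrechet (Cp X) := by
  intro f A hA
  let near (n : ℕ) (g : Cp X) : Set X := {x | dist (g.1 x) (f.1 x) < 1 / ((n : ℝ) + 1)}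
  have hΩ : ∀ n, IsOpenOmegaFamily (near n '' A n) := by
    refine fun n => ⟨?_, fun F hF => ?_⟩
    · rintro _ ⟨g, -, rfl⟩
      exact isOpen_lt (g.2.dist f.2) continuous_const
    · obtain ⟨g, hgA, hgF⟩ := ((mem_closure_iff_frequently.1 (hA n)).and_eventually
        (f.eventually_nhds_dist_lt hF Nat.one_div_pos_of_nat)).exists
      exact ⟨near n g, ⟨g, hgA, rfl⟩, hgF⟩
  obtain ⟨U, hU, hγ⟩ := h _ hΩ
  choose b hb hbU using hU
  refine ⟨b, hb, Cp.tendsto_iff.2 fun x => tendsto_iff_dist_tendsto_zero.2 ?_⟩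
  refine squeeze_zero' (.of_forall fun n => dist_nonneg) ?_ tendsto_one_div_add_atTop_nhds_zero_nat
  filter_upwards [hγ x] with n hn
  exact le_of_lt ((hbU n).symm.subset hn)

lemma exists_continuous_eq_zero_of_finite_eq_one_of_isClosed [CompletelyRegularSpace X]
    {F K : Set X} (hF : F.Finite) (hK : IsClosed K) (hd : Disjoint F K) :
    ∃ φ : X → ℝ, Continuous φ ∧ Set.EqOn φ 0 F ∧ Set.EqOn φ 1 K := by
  choose! ψ hψ h0 h1 using fun x (hx : x ∈ F) =>
    CompletelyRegularSpace.completely_regular x K hK (hd.notMem_of_mem_left hx)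
  refine ⟨fun y => ∏ x ∈ hF.toFinset, (ψ x y : ℝ), continuous_finsetProd _ fun x hx =>
    continuous_subtype_val.comp (hψ x (hF.mem_toFinset.1 hx)), fun y hy => ?_, fun y hy => ?_⟩
  · refine Finset.prod_eq_zero (hF.mem_toFinset.2 hy) ?_
    rw [h0 y hy, Set.Icc.coe_zero]
  · refine Finset.prod_eq_one fun x hx => ?_
    rw [h1 x (hF.mem_toFinset.1 hx) hy, Pi.one_apply, Set.Icc.coe_one]

lemma dense_setOf_eqOn_one_compl_of_isOpenOmegaFamily [CompletelyRegularSpace X]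
    {𝒰 : Set (Set X)} (h𝒰 : IsOpenOmegaFamily 𝒰) :
    Dense {f : Cp X | ∃ U ∈ 𝒰, Set.EqOn f.1 1 Uᶜ} := by
  refine fun g => Cp.mem_closure_of_forall_finite_eqOn fun F hF => ?_
  obtain ⟨U, hU, hFU⟩ := h𝒰.2 F hF
  obtain ⟨φ, hφ, h0, h1⟩ := exists_continuous_eq_zero_of_finite_eq_one_of_isClosed hF
    (h𝒰.1 U hU).isClosed_compl (Set.disjoint_compl_right_iff_subset.2 hFU)
  refine ⟨⟨fun x => g.1 x + φ x * (1 - g.1 x), g.2.add (hφ.mul (continuous_const.sub g.2))⟩,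
    ⟨U, hU, fun x hx => ?_⟩, fun x hx => ?_⟩
  · simp [h1 hx]
  · simp [h0 hx]

lemma StronglySeqDenseInItself.isGammaSpace [CompletelyRegularSpace X]
    (h : StronglySeqDenseInItself (Cp X)) : IsGammaSpace X := by
  intro 𝒰 h𝒰
  have hD := h _ (dense_setOf_eqOn_one_compl_of_isOpenOmegaFamily (mem_omegaCovers_iff.1 h𝒰).1)
  obtain ⟨b, hb, hlim⟩ := hD.symm.subset (Set.mem_univ ⟨fun _ => 0, continuous_const⟩)
  choose U hU hbU using hb
  refine ⟨U, hU, fun x => ?_⟩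
  filter_upwards [(Cp.tendsto_iff.1 hlim x).eventually_lt_const one_pos] with n hn
  by_contra hx
  exact hn.ne (hbU n hx)

end FunctionSpace

section Weight

open TopologicalSpace

variable {X : Type u} [TopologicalSpace X]

lemma topWeight_le_aleph0_iff : topWeight X ≤ ℵ₀ ↔ SecondCountableTopology X := by
  constructor
  · intro h
    obtain ⟨B, hB, hcard⟩ := csInf_mem
      (s := {κ | ∃ B : Set (Set X), IsTopologicalBasis B ∧ #B = κ})
      ⟨_, _, isTopologicalBasis_opens, rfl⟩
    exact hB.secondCountableTopology (le_aleph0_iff_set_countable.1 (hcard.trans_le h))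
  · intro h
    calc
      topWeight X ≤ #(countableBasis X) :=
        csInf_le' ⟨_, isBasis_countableBasis X, rfl⟩
      _ ≤ ℵ₀ := le_aleph0_iff_set_countable.2 (countable_countableBasis X)

lemma cardinal_sInf_eq_iff_mem {S : Set Cardinal.{u}} {κ : Cardinal.{u}} (hκ : κ ≠ 0)
    (hS : ∀ τ ∈ S, κ ≤ τ) : sInf S = κ ↔ κ ∈ S := by
  constructor
  · rintro rfl
    refine csInf_mem (Set.nonempty_iff_ne_empty.2 ?_)
    rintro rfl
    exact hκ Cardinal.sInf_empty
  · exact fun h => (csInf_le' h).antisymm (le_csInf ⟨κ, h⟩ hS)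

lemma iWeight_eq_aleph0_iff_exists_secondCountable :
    iWeight X = ℵ₀ ↔ ∃ (Y : Type u) (_ : TopologicalSpace Y) (f : X → Y),
      T35Space Y ∧ Continuous f ∧ Function.Bijective f ∧ SecondCountableTopology Y := by
  rw [iWeight, cardinal_sInf_eq_iff_mem aleph0_ne_zero fun _ hτ => hτ.1]
  simp only [Set.mem_ofPred_eq, le_refl, true_and, topWeight_le_aleph0_iff]

lemma exists_continuous_injective_nat_real [T3Space X] [SecondCountableTopology X] :
    ∃ e : X → ℕ → ℝ, Continuous e ∧ Function.Injective e := by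
  obtain ⟨e, he⟩ := exists_embedding_l_infty X
  exact ⟨fun x => e x, BoundedContinuousFunction.continuous_coe.comp he.continuous,
    DFunLike.coe_injective.comp he.injective⟩

lemma iWeight_eq_aleph0_iff_exists_injective :
    iWeight X = ℵ₀ ↔ ∃ e : X → ℕ → ℝ, Continuous e ∧ Function.Injective e := by
  rw [iWeight_eq_aleph0_iff_exists_secondCountable]
  constructor
  · rintro ⟨Y, _, f, _, hf, hbij, _⟩
    obtain ⟨e, he, hinj⟩ := exists_continuous_injective_nat_real (X := Y)
    exact ⟨e ∘ f, he.comp hf, hinj.comp hbij.injective⟩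
  · rintro ⟨e, he, hinj⟩
    let t : TopologicalSpace X := .induced e inferInstance
    have hemb : @IsEmbedding X (ℕ → ℝ) t _ e := @IsEmbedding.mk _ _ t _ _ ⟨rfl⟩ hinj
    exact ⟨X, t, id, hemb.t35Space, continuous_id_iff_le.2 he.le_induced, Function.bijective_id,
      secondCountableTopology_induced X (ℕ → ℝ) e⟩

lemma exists_continuous_injective_of_separableSpace_cp [T35Space X]
    [SeparableSpace (Cp X)] :
    ∃ e : X → ℕ → ℝ, Continuous e ∧ Function.Injective e := by
  let d := denseSeq (Cp X)
  refine ⟨fun x n => (d n).1 x, continuous_pi fun n => (d n).2, fun x y hxy => ?_⟩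
  by_contra hne
  obtain ⟨φ, hφ, hφxy⟩ := separatesPoints_continuous_of_t35Space hne
  have hopen : IsOpen {f : Cp X | f.1 x ≠ f.1 y} :=
    isOpen_ne_fun (Cp.continuous_eval x) (Cp.continuous_eval y)
  obtain ⟨n, hn⟩ := (denseRange_denseSeq (Cp X)).exists_mem_open hopen
    ⟨⟨φ, hφ⟩, hφxy⟩
  exact hn (congrFun hxy n)

lemma exists_continuousMap_eqOn_of_finite {K : Type*} [TopologicalSpace K] [T4Space K] {F : Set K}
    (hF : F.Finite) (r : K → ℝ) : ∃ g : C(K, ℝ), Set.EqOn g r F := by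
  have := hF.to_subtype
  obtain ⟨g, hg⟩ := ContinuousMap.exists_restrict_eq hF.isClosed
    (⟨F.domRestrict r, continuous_of_discreteTopology⟩ : C(F, ℝ))
  exact ⟨g, fun x hx => DFunLike.congr_fun hg ⟨x, hx⟩⟩

/-- Composition with a continuous map `e`, from the continuous functions on `K` with the
compact-open topology to `C_p(X)`. -/
def Cp.precomp {K : Type*} [TopologicalSpace K] (e : C(X, K)) (g : C(K, ℝ)) : Cp X :=
  ⟨g ∘ e, g.continuous.comp e.continuous⟩

lemma Cp.continuous_precomp {K : Type*} [TopologicalSpace K] (e : C(X, K)) :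
    Continuous (Cp.precomp e) :=
  Continuous.subtype_mk (continuous_pi fun x => continuous_eval_const (e x)) _

lemma Cp.denseRange_precomp {K : Type*} [TopologicalSpace K] [T4Space K] {e : C(X, K)}
    (he : Function.Injective e) : DenseRange (Cp.precomp e) := by
  refine fun f => Cp.mem_closure_of_forall_finite_eqOn fun F hF => ?_
  obtain ⟨g, hg⟩ := exists_continuousMap_eqOn_of_finite (hF.image e) (Function.extend e f.1 0)
  refine ⟨_, ⟨g, rfl⟩, fun x hx => ?_⟩
  exact (hg ⟨x, hx, rfl⟩).trans (he.extend_apply f.1 0 x)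

lemma separableSpace_cp_of_continuous_injective {e : X → ℕ → ℝ} (he : Continuous e)
    (hinj : Function.Injective e) : SeparableSpace (Cp X) := by
  let e' : C(X, ℕ → EReal) := ⟨fun x n => (e x n : EReal),
    continuous_pi fun n => continuous_coe_real_ereal.comp ((continuous_apply n).comp he)⟩
  have he' : Function.Injective e' := fun x y hxy =>
    hinj (funext fun n => EReal.coe_injective (congrFun hxy n))
  exact (Cp.denseRange_precomp he').separableSpace (Cp.continuous_precomp e')

lemma iWeight_eq_aleph0_iff_separableSpace_cp [T35Space X] :
    iWeight X = ℵ₀ ↔ SeparableSpace (Cp X) := by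
  rw [iWeight_eq_aleph0_iff_exists_injective]
  exact ⟨fun ⟨_, he, hinj⟩ => separableSpace_cp_of_continuous_injective he hinj,
    fun _ => exists_continuous_injective_of_separableSpace_cp⟩

end Weight

theorem mainTheorem1 (X : Type u) [TopologicalSpace X] [T35Space X] [Nonempty X] :
    List.TFAE [
      SelOne (DenseSets (Cp X)) (SeqDenseSets (Cp X)),
      StronglySeqDenseInItself (Cp X) ∧ TopologicalSpace.SeparableSpace (Cp X),
      SelOne (OmegaCovers X) (GammaCovers X) ∧ iWeight X = ℵ₀,
      (∀ f : Cp X, SelOne (OmegaAt f) (GammaAt f)) ∧ TopologicalSpace.SeparableSpace (Cp X),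
      (∀ f : Cp X, SelOne (DenseSets (Cp X)) (GammaAt f)) ∧
        TopologicalSpace.SeparableSpace (Cp X),
      SelFin (DenseSets (Cp X)) (SeqDenseSets (Cp X)),
      SelFin (OmegaCovers X) (GammaCovers X) ∧ iWeight X = ℵ₀,
      (∀ f : Cp X, SelFin (OmegaAt f) (GammaAt f)) ∧ TopologicalSpace.SeparableSpace (Cp X),
      (∀ f : Cp X, SelFin (DenseSets (Cp X)) (GammaAt f)) ∧
        TopologicalSpace.SeparableSpace (Cp X)] := by
  rw [iWeight_eq_aleph0_iff_separableSpace_cp]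
  have hΩ (f : Cp X) : ∀ D ∈ DenseSets (Cp X), ∃ A ∈ OmegaAt f, A ⊆ D :=
    fun _ hD => exists_subset_mem_omegaAt_of_dense f hD
  have hFrechet (h : SelFin (OmegaCovers X) (GammaCovers X)) : StrictlyFrechet (Cp X) :=
    h.isGammaSpace.hasGammaSelections.strictlyFrechet_cp
  tfae_have 1 → 6 := SelOne.selFin
  tfae_have 6 → 2 := fun h => ⟨h.stronglySeqDenseInItself, h.separableSpace⟩
  tfae_have 2 → 3 := fun h => ⟨h.1.isGammaSpace.hasGammaSelections.selOne, h.2⟩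
  tfae_have 3 → 7 := fun h => ⟨h.1.selFin, h.2⟩
  tfae_have 7 → 1 := fun ⟨h, _⟩ => (hFrechet h).selOne_dense_seqDense
  tfae_have 7 → 4 := fun h => ⟨(hFrechet h.1).selOne_omegaAt_gammaAt, h.2⟩
  tfae_have 4 → 5 := fun h => ⟨fun f => (h.1 f).of_forall_exists_subset (hΩ f), h.2⟩
  tfae_have 4 → 8 := fun h => ⟨fun f => (h.1 f).selFin, h.2⟩
  tfae_have 5 → 9 := fun h => ⟨fun f => (h.1 f).selFin, h.2⟩
  tfae_have 8 → 9 := fun h => ⟨fun f => (h.1 f).of_forall_exists_subset (hΩ f), h.2⟩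
  tfae_have 9 → 2 := fun h => ⟨stronglySeqDenseInItself_of_selFin_gammaAt h.1, h.2⟩
  tfae_finish
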